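/- Let $d\ge 0$ be an integer and let $$\mathcal{HS}_{d+1}=\{(x_1,\dots,x_{d+1})\in\mathbb Z^{d+1} : x_1+\cdots+x_{d+1}\ge 0\},$$ partially ordered by $u\ge v$ if and only if $u-v\in\mathbb Z_{\ge 0}^{d+1}$. This poset is graded; its $t$-th layer is $L_t=\{x\in\mathbb Z^{d+1} : x_1+\cdots+x_{d+1}=t\}$, for $t\ge 0$. Write $u\lessdot v$ if $v$ covers $u$, and let $\mathfrak p(v)=\{u : u\lessdot v\}$; it has exactly $d+1$ elements when $v\notin L_0$, and is empty when $v\in L_0$. Let $\alpha_1,\dots,\alpha_{d+1},\varepsilon,\sigma_0^2>0$ and $\mu_0\in\mathbb R$. Let $X_0\sim\mathcal N(\mu_0,\sigma_0^2)$ and let $W_{u\to v}\sim\mathcal N(0,1)$, for all pairs $u\lessdot v$ in $\mathcal{HS}_{d+1}$, be random variables such that $X_0$ and all the $W_{u\to v}$ are mutually independent. Put $X_v=X_0$ for every $v\in L_0$ and, for $v\in L_t$ with $t\ge 1$, define recursively $$X_v=\alpha_{|\mathfrak p(v)|}\sum_{u\in\mathfrak p(v)}\bigl(X_u+\varepsilon\,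 W_{u\to v}\bigr)$$ (so only the parameter $\alpha=\alpha_{d+1}$ matters). A window of width $N$ is a set $\bigl([x_1,x_1+N)\times\cdots\times[x_{d+1},x_{d+1}+N)\bigr)\cap\mathcal{HS}_{d+1}$ with $x_1,\dots,x_{d+1}\in\mathbb Z$. We say that local reconstruction with windows of width $N$ is possible if there are windows $\mathcal W_0,\mathcal W_1,\dots$ of width $N$ and a function $c:\mathcal{HS}_{d+1}\to\mathbb R$ such that, for every $t\ge 0$, the restriction of $c$ to $L_t$ is supported on $\mathcal W_t$, and such that the random variables $\zeta_t=\sum_{u\in L_t}c_uX_u$ satisfy $\operatorname{Var}(\zeta_t)>0$ for every $t\ge 0$, while the correlation $$\frac{\operatorname{Cov}(\zeta_t,X_0)}{\sqrt{\operatorname{Var}(\zeta_t)\operatorname{Var}(X_0)}}$$ does not converge to $0$ as $t\to\infty$. Local reconstruction is possible if this holds for some finite $N$; single-vertex reconstruction is possible if this holds for $N=1$. Then, for every $d\ge 0$ and every choice of the parameters $\alpha_1,\dots,\alpha_{d+1},\varepsilon,\mu_0,\sigma_0^2$ as above, local reconstruction is possible if and only if single-vertex reconstruction is possible. -/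

import Mathlib

open MeasureTheory ProbabilityTheory Filter Topology
open scoped NNReal

noncomputable section

namespace Reconstruction

section Model

variable {P : Type*} [PartialOrder P] {Ω : Type*}

/-- The cover relations `u ⋖ v` of the poset `P`; they index the noises `W_{u → v}`. -/
abbrev CoverPair (P : Type*) [PartialOrder P] : Type _ := {e : P × P // e.1 ⋖ e.2}

/-- The law of the inputs of the model: `X₀ ∼ N(μ₀, σ₀²)`, each `W_{u → v} ∼ N(0, 1)`, and all of
these random variables together are mutually independent. -/
structure IsInput [MeasurableSpace Ω] (μ₀ : ℝ) (σ₀sq : ℝ≥0) (X₀ : Ω → ℝ)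
    (W : CoverPair P → Ω → ℝ) (μ : Measure Ω) : Prop where
  law_X₀ : HasLaw X₀ (gaussianReal μ₀ σ₀sq) μ
  law_W : ∀ e, HasLaw (W e) (gaussianReal 0 1) μ
  indep : iIndepFun (fun o : Option (CoverPair P) => o.elim X₀ W) μ

/-- Such inputs exist. -/
theorem exists_isInput (P : Type*) [PartialOrder P] (μ₀ : ℝ) (σ₀sq : ℝ≥0) :
    ∃ (μ : Measure (Option (CoverPair P) → ℝ)) (X₀ : (Option (CoverPair P) → ℝ) → ℝ)
      (W : CoverPair P → (Option (CoverPair P) → ℝ) → ℝ),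
      IsProbabilityMeasure μ ∧ IsInput μ₀ σ₀sq X₀ W μ := by
  let ν : Option (CoverPair P) → Measure ℝ :=
    fun o => o.elim (gaussianReal μ₀ σ₀sq) (fun _ => gaussianReal 0 1)
  have hν : ∀ o, IsProbabilityMeasure (ν o) := by
    rintro (_ | e)
    · show IsProbabilityMeasure (gaussianReal μ₀ σ₀sq)
      infer_instance
    · show IsProbabilityMeasure (gaussianReal 0 1)
      infer_instance
  refine ⟨Measure.infinitePi ν, fun ω => ω none, fun e ω => ω (some e), inferInstance,
    (measurePreserving_eval_infinitePi ν none).hasLaw,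
    fun e => (measurePreserving_eval_infinitePi ν (some e)).hasLaw, ?_⟩
  have h := iIndepFun_infinitePi (P := ν) (X := fun _ x => x) (fun _ => measurable_id)
  convert h using 1
  funext o
  cases o <;> rfl

/-- The model recurrence, run for a given number of steps: `X₀` after zero steps, and
`α_{|𝔭(v)|} ∑_{u ∈ 𝔭(v)} (X_u + ε W_{u → v})` afterwards, where `𝔭(v)` is the set of elements
covered by `v`. -/
def iterate (α : ℕ → ℝ) (ε : ℝ) (X₀ : Ω → ℝ) (W : CoverPair P → Ω → ℝ) : ℕ → P → Ω → ℝ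
  | 0, _ => X₀
  | n + 1, v => fun ω => α {u : P | u ⋖ v}.ncard *
      ∑ᶠ u : {u : P // u ⋖ v}, (iterate α ε X₀ W n u.1 ω + ε * W ⟨(u.1, v), u.2⟩ ω)

variable [GradeMinOrder ℕ P]

/-- The random variable `X_v`. See `X_of_rank_zero` and `X_recurrence`. -/
def X (α : ℕ → ℝ) (ε : ℝ) (X₀ : Ω → ℝ) (W : CoverPair P → Ω → ℝ) (v : P) : Ω → ℝ :=
  iterate α ε X₀ W (grade ℕ v) v

theorem X_of_rank_zero (α : ℕ → ℝ) (ε : ℝ) (X₀ : Ω → ℝ) (W : CoverPair P → Ω → ℝ) (v : P)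
    (hv : grade ℕ v = 0) : X α ε X₀ W v = X₀ := by
  simp [X, hv, iterate]

theorem X_recurrence (α : ℕ → ℝ) (ε : ℝ) (X₀ : Ω → ℝ) (W : CoverPair P → Ω → ℝ) (v : P)
    (hv : 1 ≤ grade ℕ v) (ω : Ω) :
    X α ε X₀ W v ω = α {u : P | u ⋖ v}.ncard *
      ∑ᶠ u : {u : P // u ⋖ v}, (X α ε X₀ W u.1 ω + ε * W ⟨(u.1, v), u.2⟩ ω) := by
  obtain ⟨n, hn⟩ := Nat.exists_eq_add_of_le' hv
  have h : ∀ u : {u : P // u ⋖ v}, grade ℕ u.1 = n := fun u => by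
    have := Order.covBy_iff_add_one_eq.1 (u.2.grade ℕ)
    omega
  simp only [X, h]
  rw [hn]
  rfl

/-- The layer `L_t`: the elements of rank `t`. -/
def layer (P : Type*) [PartialOrder P] [GradeMinOrder ℕ P] (t : ℕ) : Set P := {u | grade ℕ u = t}

/-- The estimator `ζ_t = ∑_{u ∈ L_t} c_u X_u`, for `c` with finite support on each layer. -/
def zeta (α : ℕ → ℝ) (ε : ℝ) (X₀ : Ω → ℝ) (W : CoverPair P → Ω → ℝ) (c : P → ℝ) (t : ℕ) : Ω → ℝ :=
  fun ω => ∑ᶠ u ∈ layer P t, c u * X α ε X₀ W u ω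

end Model

/-- The correlation of two real random variables. -/
def corr {Ω : Type*} [MeasurableSpace Ω] (Y Z : Ω → ℝ) (μ : Measure Ω) : ℝ :=
  covariance Y Z μ / √(variance Y μ * variance Z μ)

section Grid

variable {d : ℕ} {P : Set (Fin (d + 1) → ℤ)}

/-- The window `([x₁, x₁ + N) × ⋯ × [x_{d+1}, x_{d+1} + N)) ∩ P` of width `N` in `P`. -/
def window (P : Set (Fin (d + 1) → ℤ)) (N : ℕ) (x : Fin (d + 1) → ℤ) : Set P :=
  {u | ∀ i, u.1 i ∈ Set.Ico (x i) (x i + N)}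

variable [GradeMinOrder ℕ P] {Ω : Type*} [MeasurableSpace Ω]

/-- Local reconstruction is possible with windows of width `N`: there are windows `𝒲_t` of width
`N` with corners `x t`, and coefficients `c` supported, on each layer `L_t`, on `𝒲_t`, such that
every `ζ_t` has positive variance and the correlation of `ζ_t` and `X₀` does not tend to `0`. -/
def LocalReconstructionOfWidth (N : ℕ) (α : ℕ → ℝ) (ε : ℝ) (X₀ : Ω → ℝ)
    (W : CoverPair P → Ω → ℝ) (μ : Measure Ω) : Prop :=
  ∃ (x : ℕ → Fin (d + 1) → ℤ) (c : P → ℝ),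
    (∀ t, ∀ u ∈ layer P t, c u ≠ 0 → u ∈ window P N (x t)) ∧
    (∀ t, 0 < variance (zeta α ε X₀ W c t) μ) ∧
    ¬ Tendsto (fun t => corr (zeta α ε X₀ W c t) X₀ μ) atTop (𝓝 0)

/-- Local reconstruction is possible. -/
def LocalReconstruction (α : ℕ → ℝ) (ε : ℝ) (X₀ : Ω → ℝ) (W : CoverPair P → Ω → ℝ)
    (μ : Measure Ω) : Prop :=
  ∃ N : ℕ, LocalReconstructionOfWidth N α ε X₀ W μ

/-- Single-vertex reconstruction is possible. -/
def SingleVertexReconstruction (α : ℕ → ℝ) (ε : ℝ) (X₀ : Ω → ℝ) (W : CoverPair P → Ω → ℝ)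
    (μ : Measure Ω) : Prop :=
  LocalReconstructionOfWidth 1 α ε X₀ W μ

end Grid

/-- The half-space `ℋ𝒮_{d+1}`. As a subtype of `Fin (d + 1) → ℤ` it carries the entrywise order. -/
def HS (d : ℕ) : Set (Fin (d + 1) → ℤ) := {x | 0 ≤ ∑ i, x i}

theorem HS_le_iff {d : ℕ} (u v : HS d) : v ≤ u ↔ ∀ i, 0 ≤ (u.1 - v.1) i := by
  simp only [Pi.sub_apply, sub_nonneg]
  exact Iff.rfl

theorem HS_sum_lt {d : ℕ} {u v : HS d} (h : u < v) : ∑ i, u.1 i < ∑ i, v.1 i := by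
  have h' : u.1 < v.1 := h
  obtain ⟨hle, i, hi⟩ := Pi.lt_def.1 h'
  exact Finset.sum_lt_sum (fun i _ => hle i) ⟨i, Finset.mem_univ i, hi⟩

theorem HS_sum_sub_single {d : ℕ} (v : Fin (d + 1) → ℤ) (i : Fin (d + 1)) :
    ∑ j, (v - Pi.single i 1 : Fin (d + 1) → ℤ) j = ∑ j, v j - 1 := by
  simp [Finset.sum_sub_distrib]

/-- The elements covered by `v` are the `v - eᵢ` that lie in the half-space. -/
theorem HS_covBy_iff {d : ℕ} (u v : HS d) : u ⋖ v ↔ ∃ i, u.1 = v.1 - Pi.single i 1 := by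
  constructor
  · intro h
    have h' : u.1 < v.1 := h.1
    obtain ⟨hle, i, hi⟩ := Pi.lt_def.1 h'
    refine ⟨i, ?_⟩
    have hu := u.2
    have hlt := HS_sum_lt h.1
    have hs := HS_sum_sub_single v.1 i
    have hw : v.1 - Pi.single i 1 ∈ HS d := by
      simp only [HS, Set.mem_ofPred_eq] at hu ⊢
      omega
    have hwv : (⟨v.1 - Pi.single i 1, hw⟩ : HS d) < v := by
      show v.1 - Pi.single i 1 < v.1
      refine sub_lt_self _ ?_
      exact Pi.single_pos.2 one_pos
    have huw : u ≤ ⟨v.1 - Pi.single i 1, hw⟩ := by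
      show u.1 ≤ v.1 - Pi.single i 1
      intro j
      rcases eq_or_ne j i with rfl | hj
      · simp only [Pi.sub_apply, Pi.single_eq_same]
        omega
      · simpa [hj] using hle j
    rcases huw.eq_or_lt with he | hl
    · exact congrArg Subtype.val he
    · exact absurd hwv (h.2 hl)
  · rintro ⟨i, hi⟩
    have hs := HS_sum_sub_single v.1 i
    rw [← hi] at hs
    refine ⟨?_, fun w h₁ h₂ => ?_⟩
    · show u.1 < v.1
      rw [hi]
      exact sub_lt_self _ (Pi.single_pos.2 one_pos)
    · have := HS_sum_lt h₁
      have := HS_sum_lt h₂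
      omega

/-- Every element of positive rank covers exactly `d + 1` elements. -/
theorem HS_ncard_covered {d : ℕ} (v : HS d) (hv : 1 ≤ ∑ i, v.1 i) :
    {u : HS d | u ⋖ v}.ncard = d + 1 := by
  have hw : ∀ i, v.1 - Pi.single i 1 ∈ HS d := fun i => by
    have hs := HS_sum_sub_single v.1 i
    simp only [HS, Set.mem_ofPred_eq]
    omega
  let f : Fin (d + 1) → HS d := fun i => ⟨v.1 - Pi.single i 1, hw i⟩
  have hf : Function.Injective f := fun i j h => by
    have h1 : v.1 - Pi.single i 1 = v.1 - Pi.single j 1 := congrArg Subtype.val h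
    by_contra hne
    have h2 := congrFun (sub_right_injective h1) i
    simp [hne] at h2
  have hr : {u : HS d | u ⋖ v} = Set.range f := by
    ext u
    simp only [Set.mem_ofPred_eq, HS_covBy_iff, Set.mem_range]
    exact exists_congr fun i => ⟨fun h => Subtype.ext h.symm, fun h => congrArg Subtype.val h.symm⟩
  rw [hr, ← Set.image_univ, Set.ncard_image_of_injective _ hf, Set.ncard_univ]
  simp

/-- The half-space is graded by the sum of the entries. -/
instance HS_gradeMinOrder (d : ℕ) : GradeMinOrder ℕ (HS d) where
  grade v := (∑ i, v.1 i).toNat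
  grade_strictMono u v h := by
    have := HS_sum_lt h
    have hu : 0 ≤ ∑ i, u.1 i := u.2
    show (∑ i, u.1 i).toNat < (∑ i, v.1 i).toNat
    omega
  covBy_grade u v h := by
    obtain ⟨i, hi⟩ := (HS_covBy_iff u v).1 h
    have hs := HS_sum_sub_single v.1 i
    rw [← hi] at hs
    have hu : 0 ≤ ∑ i, u.1 i := u.2
    rw [Order.covBy_iff_add_one_eq]
    omega
  isMin_grade v h := by
    have hv : 0 ≤ ∑ i, v.1 i := v.2
    suffices h0 : (∑ i, v.1 i).toNat = 0 by rw [h0]; exact isMin_bot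
    by_contra hne
    have hs := HS_sum_sub_single v.1 0
    have hw : v.1 - Pi.single 0 1 ∈ HS d := by
      simp only [HS, Set.mem_ofPred_eq]
      omega
    exact not_isMin_of_lt ((HS_covBy_iff ⟨_, hw⟩ v).2 ⟨0, rfl⟩).1 h

theorem HS_grade {d : ℕ} (v : HS d) : ((grade ℕ v : ℕ) : ℤ) = ∑ i, v.1 i :=
  Int.toNat_of_nonneg v.2

end Reconstruction

end

/-! Put `n = d + 1` and `b = α n * n`. Unrolling the recurrence downwards from `u ∈ L_t`, the noise
entering at depth `k` is weighted by `b ^ k` times the law of `k` steps of a random walk from `u`,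
and `X₀` by `b ^ t`. Encoding these laws as vectors `w_k(u)` on an orthonormal family indexed by
`ℤ^n`, `⟪w_k(u), w_k(v)⟫` is the probability that independent walks from `u` and `v` are at the same
point after `k` steps, and `Cov(X_u, X_v)` is `b^(2t) σ₀²` plus a constant times `∑_{k<t} b^(2k)
⟪w_k(u), w_k(v)⟫` (`IsInput.covariance_XExt_XExt`).

If `b > 1`, a single vertex suffices: its variance is at most a constant times `b^(2t)`, by a
geometric series (`not_tendsto_vertexCorr`).

If `b ≤ 1`, a window beats a single vertex by at most a constant factor. As `w_{k+1}(u)` is the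
average of the vectors `w_k(u - eᵢ)`, their mutual squared distances measure the drop of `‖w_k‖²`,
and the sum over `k` telescopes. So `∑ₖ ‖w_k(u) - w_k(v)‖²` is bounded uniformly over nearby `u`,
`v` in one layer. Replacing every vertex of the window by a single one thus changes the noise by at
most a multiple of `∑ c_u²`, which is itself the depth-zero noise of the estimator
(`exists_sq_mul_sum_le`). -/

namespace Reconstruction

/-! ### Random walk laws as Hilbert space vectors. -/

section Walk

variable {E : Type*} [NormedAddCommGroup E] [InnerProductSpace ℝ E] {d : ℕ}

/-- The law of `k` steps of the walk from `u` that subtracts a uniformly random unit vector at each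
step, as a combination of the vectors `e v`. -/
noncomputable def walkVec (e : (Fin (d + 1) → ℤ) → E) : ℕ → (Fin (d + 1) → ℤ) → E
  | 0, u => e u
  | k + 1, u => ((d + 1 : ℕ) : ℝ)⁻¹ • ∑ i, walkVec e k (u - Pi.single i 1)

variable {e : (Fin (d + 1) → ℤ) → E}

theorem inner_walkVec_succ (k : ℕ) (u v : Fin (d + 1) → ℤ) :
    inner ℝ (walkVec e (k + 1) u) (walkVec e (k + 1) v) = (((d + 1 : ℕ) : ℝ) ^ 2)⁻¹ *
      ∑ i, ∑ j, inner ℝ (walkVec e k (u - Pi.single i 1)) (walkVec e k (v - Pi.single j 1)) := by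
  simp only [walkVec, inner_smul_left, inner_smul_right, sum_inner, inner_sum]
  simp only [conj_trivial]
  rw [← Finset.mul_sum, ← mul_assoc, sq, mul_inv, Finset.sum_comm]

theorem inner_walkVec_add (he : Orthonormal ℝ e) (k : ℕ) (z u v : Fin (d + 1) → ℤ) :
    inner ℝ (walkVec e k (u + z)) (walkVec e k (v + z)) =
      inner ℝ (walkVec e k u) (walkVec e k v) := by
  classical
  induction k generalizing u v with
  | zero => simp [walkVec, orthonormal_iff_ite.1 he]
  | succ k ih => simp only [inner_walkVec_succ, add_sub_right_comm, ih]

theorem norm_walkVec (he : Orthonormal ℝ e) (k : ℕ) (u : Fin (d + 1) → ℤ) :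
    ‖walkVec e k u‖ = ‖walkVec e k 0‖ := by
  have h := inner_walkVec_add he k u 0 0
  rw [zero_add, real_inner_self_eq_norm_sq, real_inner_self_eq_norm_sq] at h
  exact (sq_eq_sq₀ (norm_nonneg _) (norm_nonneg _)).1 h

theorem sum_sum_norm_sub_sq {ι : Type*} [Fintype ι] (x : ι → E) :
    ∑ i, ∑ j, ‖x i - x j‖ ^ 2 = 2 * Fintype.card ι * ∑ i, ‖x i‖ ^ 2 - 2 * ‖∑ i, x i‖ ^ 2 := by
  have h : ‖∑ i, x i‖ ^ 2 = ∑ i, ∑ j, inner ℝ (x i) (x j) := by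
    rw [← real_inner_self_eq_norm_sq, sum_inner]
    simp only [inner_sum]
  simp only [norm_sub_sq_real, Finset.sum_add_distrib, Finset.sum_sub_distrib, h, Finset.sum_const,
    Finset.card_univ, nsmul_eq_mul, ← Finset.mul_sum]
  ring

/-- The averaged vectors all have the same norm by translation invariance, so their pairwise spread
is exactly the squared norm lost by averaging. The right side telescopes in `k`. -/
theorem norm_walkVec_succ_sq (he : Orthonormal ℝ e) (k : ℕ) (u : Fin (d + 1) → ℤ) :
    ∑ i : Fin (d + 1), ∑ j : Fin (d + 1),
      ‖walkVec e k (u - Pi.single i 1) - walkVec e k (u - Pi.single j 1)‖ ^ 2 =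
    2 * ((d + 1 : ℕ) : ℝ) ^ 2 * (‖walkVec e k 0‖ ^ 2 - ‖walkVec e (k + 1) 0‖ ^ 2) := by
  have hn : ((d + 1 : ℕ) : ℝ) ≠ 0 := by positivity
  rw [sum_sum_norm_sub_sq, ← norm_walkVec he (k + 1) u]
  simp only [walkVec, norm_smul, mul_pow, norm_walkVec he k, Finset.sum_const, Finset.card_univ,
    Fintype.card_fin, nsmul_eq_mul, norm_inv, Real.norm_natCast]
  field_simp

theorem norm_walkVec_le_one (he : Orthonormal ℝ e) (k : ℕ) : ‖walkVec e k 0‖ ^ 2 ≤ 1 := by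
  induction k with
  | zero => simp [walkVec, he.1]
  | succ k ih =>
    have h := norm_walkVec_succ_sq he k 0
    have h0 : 0 ≤ 2 * ((d + 1 : ℕ) : ℝ) ^ 2 * (‖walkVec e k 0‖ ^ 2 - ‖walkVec e (k + 1) 0‖ ^ 2) :=
      h ▸ Finset.sum_nonneg fun i _ => Finset.sum_nonneg fun j _ => sq_nonneg _
    have := nonneg_of_mul_nonneg_right h0 (by positivity)
    linarith

theorem sum_norm_walkVec_step_le (he : Orthonormal ℝ e) (t : ℕ) (u : Fin (d + 1) → ℤ)
    (i j : Fin (d + 1)) :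
    ∑ k ∈ Finset.range t,
      ‖walkVec e k (u - Pi.single i 1) - walkVec e k (u - Pi.single j 1)‖ ^ 2 ≤
    2 * ((d + 1 : ℕ) : ℝ) ^ 2 := by
  have h : ∀ k ∈ Finset.range t,
      ‖walkVec e k (u - Pi.single i 1) - walkVec e k (u - Pi.single j 1)‖ ^ 2 ≤
      2 * ((d + 1 : ℕ) : ℝ) ^ 2 * (‖walkVec e k 0‖ ^ 2 - ‖walkVec e (k + 1) 0‖ ^ 2) := fun k _ => by
    rw [← norm_walkVec_succ_sq he k u]
    refine le_trans ?_ (Finset.single_le_sum (fun i _ => Finset.sum_nonneg fun j _ => sq_nonneg _)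
      (Finset.mem_univ i))
    exact Finset.single_le_sum (f := fun j => ‖walkVec e k (u - Pi.single i 1) -
      walkVec e k (u - Pi.single j 1)‖ ^ 2) (fun j _ => sq_nonneg _) (Finset.mem_univ j)
  refine (Finset.sum_le_sum h).trans ?_
  rw [← Finset.mul_sum, Finset.sum_range_sub']
  have h0 := norm_walkVec_le_one he 0
  have h1 := sq_nonneg ‖walkVec e t 0‖
  exact mul_le_of_le_one_right (by positivity) (by linarith)

theorem norm_add_sq_le_two_mul (x y : E) : ‖x + y‖ ^ 2 ≤ 2 * ‖x‖ ^ 2 + 2 * ‖y‖ ^ 2 := by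
  have := parallelogram_law_with_norm ℝ x y
  nlinarith [sq_nonneg ‖x - y‖]

/-- The translations `z` for which `∑ₖ ‖walkVec e k (u + z) - walkVec e k u‖²` converges. -/
noncomputable def couplingSubgroup (e : (Fin (d + 1) → ℤ) → E) : AddSubgroup (Fin (d + 1) → ℤ) where
  carrier := {z | ∃ A : ℝ, ∀ u t,
    ∑ k ∈ Finset.range t, ‖walkVec e k (u + z) - walkVec e k u‖ ^ 2 ≤ A}
  zero_mem' := ⟨0, fun u t => by simp⟩
  add_mem' := by
    rintro z w ⟨A, hA⟩ ⟨B, hB⟩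
    refine ⟨2 * B + 2 * A, fun u t => ?_⟩
    refine le_trans ?_ (add_le_add (mul_le_mul_of_nonneg_left (hB (u + z) t) zero_le_two)
      (mul_le_mul_of_nonneg_left (hA u t) zero_le_two))
    rw [Finset.mul_sum, Finset.mul_sum, ← Finset.sum_add_distrib]
    refine Finset.sum_le_sum fun k _ => ?_
    refine le_trans (le_of_eq ?_) (norm_add_sq_le_two_mul _ _)
    rw [sub_add_sub_cancel, add_assoc]
  neg_mem' := by
    rintro z ⟨A, hA⟩
    refine ⟨A, fun u t => le_trans (le_of_eq ?_) (hA (u - z) t)⟩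
    refine Finset.sum_congr rfl fun k _ => ?_
    rw [sub_add_cancel, norm_sub_rev, sub_eq_add_neg u z]

/-- The differences `eᵢ - e₀` generate the sum-zero lattice, so the one-step bound propagates
through the subgroup. -/
theorem mem_couplingSubgroup (he : Orthonormal ℝ e) {z : Fin (d + 1) → ℤ} (hz : ∑ i, z i = 0) :
    z ∈ couplingSubgroup e := by
  have hstep : ∀ i : Fin (d + 1),
      (Pi.single i 1 - Pi.single 0 1 : Fin (d + 1) → ℤ) ∈ couplingSubgroup e := fun i => by
    refine ⟨2 * ((d + 1 : ℕ) : ℝ) ^ 2, fun u t => ?_⟩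
    -- Seen from the base point `u + eᵢ`, removing `e₀` gives `u + (eᵢ - e₀)` and removing `eᵢ`
    -- gives `u`.
    refine le_trans (le_of_eq (Finset.sum_congr rfl fun k _ => ?_))
      (sum_norm_walkVec_step_le he t (u + Pi.single i 1) 0 i)
    rw [add_sub_cancel_right, add_sub_assoc]
  have h : z = ∑ i, z i • (Pi.single i 1 - Pi.single 0 1 : Fin (d + 1) → ℤ) := by
    simp only [smul_sub, Finset.sum_sub_distrib, ← Finset.sum_smul, hz, zero_smul, sub_zero]
    ext j
    simp [Finset.sum_apply, Pi.single_apply]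
  rw [h]
  exact sum_mem fun i _ => zsmul_mem (hstep i) _

theorem exists_sum_norm_walkVec_sub_le (he : Orthonormal ℝ e) (N : ℕ) :
    ∃ A : ℝ, 0 ≤ A ∧ ∀ u v : Fin (d + 1) → ℤ, ∑ i, u i = ∑ i, v i → (∀ i, |u i - v i| ≤ N) → ∀ t,
      ∑ k ∈ Finset.range t, ‖walkVec e k u - walkVec e k v‖ ^ 2 ≤ A := by
  have h : ∀ z : Fin (d + 1) → ℤ, ∃ A : ℝ, 0 ≤ A ∧ (∑ i, z i = 0 → ∀ u t,
      ∑ k ∈ Finset.range t, ‖walkVec e k (u + z) - walkVec e k u‖ ^ 2 ≤ A) := fun z => by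
    by_cases hz : ∑ i, z i = 0
    · obtain ⟨A, hA⟩ := mem_couplingSubgroup he hz
      exact ⟨A, by simpa using hA 0 0, fun _ => hA⟩
    · exact ⟨0, le_rfl, fun h => absurd h hz⟩
  choose A hA0 hA using h
  -- Only finitely many displacements occur; the sum of their constants serves as a common bound.
  refine ⟨∑ z ∈ Finset.Icc (fun _ => -(N : ℤ)) (fun _ => (N : ℤ)), A z,
    Finset.sum_nonneg fun z _ => hA0 z, fun u v huv hN t => ?_⟩
  have h1 := hA (u - v) (by simp [huv]) v t
  rw [add_sub_cancel] at h1
  refine h1.trans (Finset.single_le_sum (fun z _ => hA0 z) ?_)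
  rw [Finset.mem_Icc]
  exact ⟨fun i => (abs_le.1 (hN i)).1, fun i => (abs_le.1 (hN i)).2⟩

theorem norm_sum_smul_sq_le {ι : Type*} (s : Finset ι) (c : ι → ℝ) (x : ι → E) :
    ‖∑ i ∈ s, c i • x i‖ ^ 2 ≤ (∑ i ∈ s, c i ^ 2) * ∑ i ∈ s, ‖x i‖ ^ 2 := by
  refine le_trans ?_ (Finset.sum_mul_sq_le_sq_mul_sq s (fun i => |c i|) fun i => ‖x i‖) |>.trans_eq
    (by simp)
  gcongr
  refine (norm_sum_le _ _).trans_eq ?_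
  simp [norm_smul]

/-- Compares the noise of one vertex carrying the total weight `∑ c` with the noise of the
spread-out combination; `M` depends neither on `t` nor on `c`. -/
theorem exists_sq_mul_sum_le (he : Orthonormal ℝ e) {b : ℝ} (hb : 0 ≤ b) (hb1 : b ≤ 1) (N : ℕ) :
    ∃ M : ℝ, 1 ≤ M ∧ ∀ (s : Finset (Fin (d + 1) → ℤ)) (c : (Fin (d + 1) → ℤ) → ℝ) (t : ℕ),
      (∀ u ∈ s, ∀ v ∈ s, ∑ i, u i = ∑ i, v i ∧ ∀ i, |u i - v i| ≤ N) →
      (∑ u ∈ s, c u) ^ 2 * ∑ k ∈ Finset.range t, b ^ (2 * k) * ‖walkVec e k 0‖ ^ 2 ≤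
        M * ∑ k ∈ Finset.range t, b ^ (2 * k) * ‖∑ u ∈ s, c u • walkVec e k u‖ ^ 2 := by
  obtain ⟨A, hA0, hA⟩ := exists_sum_norm_walkVec_sub_le he N
  set K : ℕ := (Finset.Icc (fun _ : Fin (d + 1) => -(N : ℤ)) (fun _ => (N : ℤ))).card with hK
  refine ⟨2 + 2 * (K * A), by nlinarith [mul_nonneg (Nat.cast_nonneg (α := ℝ) K) hA0],
    fun s c t hs => ?_⟩
  rcases s.eq_empty_or_nonempty with rfl | ⟨v, hv⟩
  · simp
  rcases t with _ | t
  · simp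
  have hcard : (s.card : ℝ) ≤ K := by
    rw [Nat.cast_le, hK]
    refine Finset.card_le_card_of_injOn (fun u => u - v) (fun u hu => ?_)
      (fun u _ w _ h => sub_left_injective h)
    rw [Finset.mem_coe, Finset.mem_Icc]
    exact ⟨fun i => (abs_le.1 ((hs u hu v hv).2 i)).1, fun i => (abs_le.1 ((hs u hu v hv).2 i)).2⟩
  set Q := ∑ k ∈ Finset.range (t + 1), b ^ (2 * k) * ‖∑ u ∈ s, c u • walkVec e k u‖ ^ 2 with hQ
  -- The `k = 0` term of `Q` is `∑ c_u²` by orthonormality; this excludes cheap cancellation among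
  -- the weights.
  have hcQ : ∑ u ∈ s, c u ^ 2 ≤ Q := by
    have h0 : b ^ (2 * 0) * ‖∑ u ∈ s, c u • walkVec e 0 u‖ ^ 2 = ∑ u ∈ s, c u ^ 2 := by
      rw [mul_zero, pow_zero, one_mul, ← real_inner_self_eq_norm_sq]
      simp only [walkVec]
      rw [he.inner_sum]
      simp [sq]
    rw [← h0]
    exact Finset.single_le_sum
      (f := fun k => b ^ (2 * k) * ‖∑ u ∈ s, c u • walkVec e k u‖ ^ 2)
      (fun k _ => by positivity) (Finset.mem_range.2 t.succ_pos)
  have hpt : ∀ k ∈ Finset.range (t + 1),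
      (∑ u ∈ s, c u) ^ 2 * (b ^ (2 * k) * ‖walkVec e k 0‖ ^ 2) ≤
      2 * (b ^ (2 * k) * ‖∑ u ∈ s, c u • walkVec e k u‖ ^ 2) +
      2 * ((∑ u ∈ s, c u ^ 2) * ∑ u ∈ s, ‖walkVec e k v - walkVec e k u‖ ^ 2) := fun k _ => by
    have h1 : ‖(∑ u ∈ s, c u) • walkVec e k v‖ ^ 2 ≤ 2 * ‖∑ u ∈ s, c u • walkVec e k u‖ ^ 2 +
        2 * ((∑ u ∈ s, c u ^ 2) * ∑ u ∈ s, ‖walkVec e k v - walkVec e k u‖ ^ 2) := by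
      refine le_trans (le_of_eq ?_) ((norm_add_sq_le_two_mul (∑ u ∈ s, c u • walkVec e k u)
        (∑ u ∈ s, c u • (walkVec e k v - walkVec e k u))).trans ?_)
      · rw [← Finset.sum_add_distrib, Finset.sum_smul]
        simp only [smul_sub, add_sub_cancel]
      · gcongr
        exact norm_sum_smul_sq_le s c _
    rw [norm_smul, mul_pow, norm_walkVec he k v, Real.norm_eq_abs, sq_abs] at h1
    -- Since `b ≤ 1`, the weights can be dropped from the error term, whose unweighted sum over `k`
    -- is bounded.
    have hbk : b ^ (2 * k) ≤ 1 := pow_le_one₀ hb hb1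
    have h2 := mul_le_mul_of_nonneg_left h1 (pow_nonneg hb (2 * k))
    have h3 : 0 ≤ (∑ u ∈ s, c u ^ 2) * ∑ u ∈ s, ‖walkVec e k v - walkVec e k u‖ ^ 2 := by
      positivity
    have h4 := mul_le_mul_of_nonneg_right hbk h3
    linarith
  rw [Finset.mul_sum]
  refine (Finset.sum_le_sum hpt).trans ?_
  rw [Finset.sum_add_distrib, ← Finset.mul_sum, ← Finset.mul_sum, ← Finset.mul_sum, ← hQ,
    Finset.sum_comm]
  have h5 : ∑ u ∈ s, ∑ k ∈ Finset.range (t + 1), ‖walkVec e k v - walkVec e k u‖ ^ 2 ≤ K * A := by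
    refine (Finset.sum_le_card_nsmul s _ A fun u hu =>
      hA v u (hs v hv u hu).1 (hs v hv u hu).2 _).trans ?_
    rw [nsmul_eq_mul]
    gcongr
  have h6 := mul_le_mul hcQ h5 (by positivity) (hcQ.trans' (by positivity))
  linarith

end Walk

/-! ### Covariances of the variables `X_u`. -/

section Covariance

variable {d : ℕ} {Ω : Type*} {α : ℕ → ℝ} {ε : ℝ} {μ₀ : ℝ} {σ₀sq : ℝ≥0} {X₀ : Ω → ℝ}
  {W : CoverPair (HS d) → Ω → ℝ}

theorem sub_single_mem_HS {u : Fin (d + 1) → ℤ} (hu : 1 ≤ ∑ j, u j) (i : Fin (d + 1)) :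
    u - Pi.single i 1 ∈ HS d := by
  have hs := HS_sum_sub_single u i
  simp only [HS, Set.mem_ofPred_eq]
  omega

/-- The cover relation `u - eᵢ ⋖ u`. -/
def coverEdge (u : Fin (d + 1) → ℤ) (hu : 1 ≤ ∑ j, u j) (i : Fin (d + 1)) : CoverPair (HS d) :=
  ⟨(⟨u - Pi.single i 1, sub_single_mem_HS hu i⟩, ⟨u, zero_le_one.trans hu⟩),
    (HS_covBy_iff _ _).2 ⟨i, rfl⟩⟩

theorem coverEdge_inj {u v : Fin (d + 1) → ℤ} {hu : 1 ≤ ∑ j, u j} {hv : 1 ≤ ∑ j, v j}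
    {i j : Fin (d + 1)} : coverEdge u hu i = coverEdge v hv j ↔ u = v ∧ i = j := by
  constructor
  · intro h
    have h1 : u - Pi.single i 1 = v - Pi.single j 1 :=
      congrArg (fun e : CoverPair (HS d) => e.1.1.1) h
    have h2 : u = v := congrArg (fun e : CoverPair (HS d) => e.1.2.1) h
    subst h2
    refine ⟨rfl, ?_⟩
    by_contra hne
    have h3 := congrFun (sub_right_injective h1) i
    simp [hne] at h3
  · rintro ⟨rfl, rfl⟩
    rfl

open Classical in
/-- `X_u`, extended by zero to the whole of `ℤ^{d+1}`. -/
noncomputable def XExt (α : ℕ → ℝ) (ε : ℝ) (X₀ : Ω → ℝ) (W : CoverPair (HS d) → Ω → ℝ)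
    (u : Fin (d + 1) → ℤ) : Ω → ℝ :=
  if h : u ∈ HS d then X α ε X₀ W ⟨u, h⟩ else 0

theorem XExt_coe (u : HS d) : XExt α ε X₀ W u.1 = X α ε X₀ W u := by
  rw [XExt, dif_pos u.2]

theorem XExt_of_sum_eq_zero {u : Fin (d + 1) → ℤ} (hu : ∑ i, u i = 0) :
    XExt α ε X₀ W u = X₀ := by
  have hm : u ∈ HS d := hu.ge
  rw [XExt, dif_pos hm]
  refine X_of_rank_zero _ _ _ _ _ ?_
  have := HS_grade (⟨u, hm⟩ : HS d)
  rw [hu] at this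
  exact_mod_cast this

theorem XExt_recurrence {u : Fin (d + 1) → ℤ} (hu : 1 ≤ ∑ i, u i) :
    XExt α ε X₀ W u = fun ω => α (d + 1) *
      ∑ i, (XExt α ε X₀ W (u - Pi.single i 1) ω + ε * W (coverEdge u hu i) ω) := by
  have h0 : u ∈ HS d := zero_le_one.trans hu
  have hg := HS_grade (⟨u, h0⟩ : HS d)
  funext ω
  rw [XExt, dif_pos h0, X_recurrence _ _ _ _ _ (by simp only at hg; omega),
    HS_ncard_covered _ hu]
  congr 1
  let f : Fin (d + 1) → {w : HS d // w ⋖ ⟨u, h0⟩} := fun i =>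
    ⟨⟨u - Pi.single i 1, sub_single_mem_HS hu i⟩, (HS_covBy_iff _ _).2 ⟨i, rfl⟩⟩
  have hf : Function.Bijective f := by
    refine ⟨fun i j h => ?_, fun w => ?_⟩
    · have h1 : u - Pi.single i 1 = u - Pi.single j 1 :=
        congrArg (fun w : {w : HS d // w ⋖ ⟨u, h0⟩} => w.1.1) h
      by_contra hne
      have h3 := congrFun (sub_right_injective h1) i
      simp [hne] at h3
    · obtain ⟨i, hi⟩ := (HS_covBy_iff _ _).1 w.2
      exact ⟨i, Subtype.ext (Subtype.ext hi.symm)⟩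
  rw [← finsum_comp f hf, finsum_eq_sum_of_fintype]
  refine Finset.sum_congr rfl fun i _ => ?_
  rw [XExt, dif_pos (sub_single_mem_HS hu i)]
  rfl

variable [MeasurableSpace Ω] {μ : Measure Ω}

theorem covariance_fun_add_left [IsFiniteMeasure μ] {Y Z T : Ω → ℝ} (hY : MemLp Y 2 μ)
    (hZ : MemLp Z 2 μ) (hT : MemLp T 2 μ) :
    covariance (fun ω => Y ω + Z ω) T μ = covariance Y T μ + covariance Z T μ :=
  covariance_add_left hY hZ hT

theorem covariance_fun_add_right [IsFiniteMeasure μ] {Y Z T : Ω → ℝ} (hY : MemLp Y 2 μ)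
    (hZ : MemLp Z 2 μ) (hT : MemLp T 2 μ) :
    covariance Y (fun ω => Z ω + T ω) μ = covariance Y Z μ + covariance Y T μ :=
  covariance_add_right hY hZ hT

theorem IsInput.memLp_X₀ (h : IsInput μ₀ σ₀sq X₀ W μ) : MemLp X₀ 2 μ := by
  have := memLp_id_gaussianReal (μ := μ₀) (v := σ₀sq) 2
  rw [← h.law_X₀.map_eq] at this
  exact (memLp_map_measure_iff (by fun_prop) h.law_X₀.aemeasurable).1 this

theorem IsInput.memLp_W (h : IsInput μ₀ σ₀sq X₀ W μ) (e) : MemLp (W e) 2 μ := by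
  have := memLp_id_gaussianReal (μ := 0) (v := 1) 2
  rw [← (h.law_W e).map_eq] at this
  exact (memLp_map_measure_iff (by fun_prop) (h.law_W e).aemeasurable).1 this

theorem IsInput.variance_X₀ (h : IsInput μ₀ σ₀sq X₀ W μ) : variance X₀ μ = σ₀sq := by
  rw [h.law_X₀.variance_eq, variance_id_gaussianReal]

theorem IsInput.covariance_X₀_X₀ (h : IsInput μ₀ σ₀sq X₀ W μ) :
    covariance X₀ X₀ μ = σ₀sq := by
  rw [covariance_self h.law_X₀.aemeasurable, h.variance_X₀]

theorem IsInput.covariance_X₀_W (h : IsInput μ₀ σ₀sq X₀ W μ) (e) :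
    covariance X₀ (W e) μ = 0 :=
  (h.indep.indepFun (i := none) (j := some e) (by simp)).covariance_eq_zero h.memLp_X₀ (h.memLp_W e)

open Classical in
theorem IsInput.covariance_W_W (h : IsInput μ₀ σ₀sq X₀ W μ) (e e') :
    covariance (W e) (W e') μ = if e = e' then 1 else 0 := by
  split_ifs with he
  · subst he
    rw [covariance_self (h.law_W e).aemeasurable, (h.law_W e).variance_eq,
      variance_id_gaussianReal, NNReal.coe_one]
  · exact (h.indep.indepFun (i := some e) (j := some e') (by simpa using he)).covariance_eq_zero
      (h.memLp_W e) (h.memLp_W e')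

theorem sum_sub_single_eq {u : Fin (d + 1) → ℤ} {t : ℕ} (hu : ∑ i, u i = (t + 1 : ℕ))
    (i : Fin (d + 1)) : ∑ j, (u - Pi.single i 1 : Fin (d + 1) → ℤ) j = t := by
  rw [HS_sum_sub_single, hu]
  push_cast
  ring

theorem one_le_sum {u : Fin (d + 1) → ℤ} {t : ℕ} (hu : ∑ i, u i = (t + 1 : ℕ)) :
    1 ≤ ∑ i, u i := by
  omega

theorem IsInput.memLp_XExt [IsProbabilityMeasure μ] (h : IsInput μ₀ σ₀sq X₀ W μ) (t : ℕ)
    {u : Fin (d + 1) → ℤ} (hu : ∑ i, u i = t) : MemLp (XExt α ε X₀ W u) 2 μ := by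
  induction t generalizing u with
  | zero => rw [XExt_of_sum_eq_zero hu]; exact h.memLp_X₀
  | succ t ih =>
    rw [XExt_recurrence (one_le_sum hu)]
    exact (memLp_finsetSum _ fun i _ => (ih (sum_sub_single_eq hu i)).add
      ((h.memLp_W _).const_mul ε)).const_mul _

theorem IsInput.memLp_summand [IsProbabilityMeasure μ] (h : IsInput μ₀ σ₀sq X₀ W μ) (t : ℕ)
    {u : Fin (d + 1) → ℤ} (hu : ∑ i, u i = t) (e) :
    MemLp (fun ω => XExt α ε X₀ W u ω + ε * W e ω) 2 μ :=
  (h.memLp_XExt t hu).add ((h.memLp_W e).const_mul ε)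

/-- A vertex of layer `t` only involves noises on edges ending in layers at most `t`. -/
theorem IsInput.covariance_XExt_W [IsProbabilityMeasure μ] (h : IsInput μ₀ σ₀sq X₀ W μ) (t : ℕ)
    {u : Fin (d + 1) → ℤ} (hu : ∑ i, u i = t) (e : CoverPair (HS d)) (he : t < ∑ i, e.1.2.1 i) :
    covariance (XExt α ε X₀ W u) (W e) μ = 0 := by
  induction t generalizing u with
  | zero => rw [XExt_of_sum_eq_zero hu, h.covariance_X₀_W]
  | succ t ih =>
    have h1 := one_le_sum hu
    rw [XExt_recurrence h1, covariance_const_mul_left, covariance_fun_sum_left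
      (fun i => h.memLp_summand t (sum_sub_single_eq hu i) _) (h.memLp_W e)]
    refine mul_eq_zero_of_right _ (Finset.sum_eq_zero fun i _ => ?_)
    rw [covariance_fun_add_left (h.memLp_XExt t (sum_sub_single_eq hu i))
      ((h.memLp_W _).const_mul ε) (h.memLp_W e), covariance_const_mul_left, h.covariance_W_W,
      ih (sum_sub_single_eq hu i) (by push_cast at he; omega), if_neg, mul_zero, zero_add]
    rintro rfl
    simp only [coverEdge, hu] at he
    omega

theorem IsInput.covariance_XExt_X₀ [IsProbabilityMeasure μ] (h : IsInput μ₀ σ₀sq X₀ W μ) (t : ℕ)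
    {u : Fin (d + 1) → ℤ} (hu : ∑ i, u i = t) :
    covariance (XExt α ε X₀ W u) X₀ μ = (α (d + 1) * (d + 1 : ℕ)) ^ t * σ₀sq := by
  induction t generalizing u with
  | zero => rw [XExt_of_sum_eq_zero hu, h.covariance_X₀_X₀, pow_zero, one_mul]
  | succ t ih =>
    rw [XExt_recurrence (one_le_sum hu), covariance_const_mul_left, covariance_fun_sum_left
      (fun i => h.memLp_summand t (sum_sub_single_eq hu i) _) h.memLp_X₀]
    have hi : ∀ i, covariance (fun ω => XExt α ε X₀ W (u - Pi.single i 1) ω +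
        ε * W (coverEdge u (one_le_sum hu) i) ω) X₀ μ =
        (α (d + 1) * (d + 1 : ℕ)) ^ t * σ₀sq := fun i => by
      rw [covariance_fun_add_left (h.memLp_XExt t (sum_sub_single_eq hu i))
        ((h.memLp_W _).const_mul ε) h.memLp_X₀, covariance_const_mul_left,
        ih (sum_sub_single_eq hu i), covariance_comm (W _), h.covariance_X₀_W, mul_zero, add_zero]
    simp only [hi, Finset.sum_const, Finset.card_univ, Fintype.card_fin, nsmul_eq_mul]
    ring

variable {E : Type*} [NormedAddCommGroup E] [InnerProductSpace ℝ E] {e : (Fin (d + 1) → ℤ) → E}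

open Classical in
theorem IsInput.covariance_summand [IsProbabilityMeasure μ] (h : IsInput μ₀ σ₀sq X₀ W μ) (t : ℕ)
    {u v u' v' : Fin (d + 1) → ℤ} (hu : ∑ i, u i = (t + 1 : ℕ)) (hv : ∑ i, v i = (t + 1 : ℕ))
    (hu' : ∑ i, u' i = t) (hv' : ∑ i, v' i = t) (i j : Fin (d + 1)) :
    covariance (fun ω => XExt α ε X₀ W u' ω + ε * W (coverEdge u (one_le_sum hu) i) ω)
      (fun ω => XExt α ε X₀ W v' ω + ε * W (coverEdge v (one_le_sum hv) j) ω) μ =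
    covariance (XExt α ε X₀ W u') (XExt α ε X₀ W v') μ +
      ε ^ 2 * if u = v ∧ i = j then 1 else 0 := by
  have hW := fun e => (h.memLp_W e).const_mul ε
  have hlt : ∀ {w : Fin (d + 1) → ℤ} (hw : ∑ i, w i = (t + 1 : ℕ)) (i : Fin (d + 1)),
      (t : ℤ) < ∑ j, (coverEdge w (one_le_sum hw) i).1.2.1 j := fun hw i => by
    simp only [coverEdge, hw]
    omega
  rw [covariance_fun_add_left (h.memLp_XExt t hu') (hW _) (h.memLp_summand t hv' _),
    covariance_fun_add_right (h.memLp_XExt t hu') (h.memLp_XExt t hv') (hW _),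
    covariance_fun_add_right (hW _) (h.memLp_XExt t hv') (hW _)]
  simp only [covariance_const_mul_left, covariance_const_mul_right]
  rw [h.covariance_XExt_W t hu' _ (hlt hv j), covariance_comm (W _) (XExt α ε X₀ W v'),
    h.covariance_XExt_W t hv' _ (hlt hu i), h.covariance_W_W]
  simp only [coverEdge_inj]
  ring

theorem IsInput.covariance_XExt_XExt [IsProbabilityMeasure μ] (h : IsInput μ₀ σ₀sq X₀ W μ)
    (he : Orthonormal ℝ e) (t : ℕ)
    {u v : Fin (d + 1) → ℤ} (hu : ∑ i, u i = t) (hv : ∑ i, v i = t) :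
    covariance (XExt α ε X₀ W u) (XExt α ε X₀ W v) μ =
      (α (d + 1) * (d + 1 : ℕ)) ^ (2 * t) * σ₀sq + ε ^ 2 * α (d + 1) ^ 2 * (d + 1 : ℕ) *
      ∑ k ∈ Finset.range t, (α (d + 1) * (d + 1 : ℕ)) ^ (2 * k) *
        inner ℝ (walkVec e k u) (walkVec e k v) := by
  classical
  induction t generalizing u v with
  | zero =>
    rw [XExt_of_sum_eq_zero hu, XExt_of_sum_eq_zero hv, h.covariance_X₀_X₀]
    simp
  | succ t ih =>
    rw [XExt_recurrence (one_le_sum hu), XExt_recurrence (one_le_sum hv),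
      covariance_const_mul_left, covariance_const_mul_right, covariance_fun_sum_fun_sum
      (fun i => h.memLp_summand t (sum_sub_single_eq hu i) _)
      (fun i => h.memLp_summand t (sum_sub_single_eq hv i) _)]
    simp only [h.covariance_summand t hu hv (sum_sub_single_eq hu _) (sum_sub_single_eq hv _),
      ih (sum_sub_single_eq hu _) (sum_sub_single_eq hv _)]
    -- The fresh noise supplies the `k = 0` term; the covariances one layer down supply the others,
    -- shifted by one step.
    have h0 : ∑ i : Fin (d + 1), ∑ j : Fin (d + 1), (if u = v ∧ i = j then (1 : ℝ) else 0) =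
        (d + 1 : ℕ) * inner ℝ (walkVec e 0 u) (walkVec e 0 v) := by
      by_cases huv : u = v <;> simp [huv, walkVec, orthonormal_iff_ite.1 he, he.1]
    simp only [Finset.sum_add_distrib, Finset.sum_const, Finset.card_univ, Fintype.card_fin,
      nsmul_eq_mul, ← Finset.mul_sum, h0]
    have hk : ∑ i : Fin (d + 1), ∑ j : Fin (d + 1), ∑ k ∈ Finset.range t,
        (α (d + 1) * (d + 1 : ℕ)) ^ (2 * k) * inner ℝ (walkVec e k (u - Pi.single i 1))
          (walkVec e k (v - Pi.single j 1)) =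
        ((d + 1 : ℕ) : ℝ) ^ 2 * ∑ k ∈ Finset.range t,
          (α (d + 1) * (d + 1 : ℕ)) ^ (2 * k) *
            inner ℝ (walkVec e (k + 1) u) (walkVec e (k + 1) v) := by
      simp only [Finset.sum_comm (t := Finset.range t), ← Finset.mul_sum, inner_walkVec_succ]
      rw [Finset.mul_sum]
      refine Finset.sum_congr rfl fun k _ => ?_
      have : ((d + 1 : ℕ) : ℝ) ≠ 0 := by positivity
      field_simp
    rw [hk, Finset.sum_range_succ']
    have hsh : ∑ k ∈ Finset.range t, (α (d + 1) * (d + 1 : ℕ)) ^ (2 * (k + 1)) *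
        inner ℝ (walkVec e (k + 1) u) (walkVec e (k + 1) v) =
        (α (d + 1) * (d + 1 : ℕ)) ^ 2 * ∑ k ∈ Finset.range t, (α (d + 1) * (d + 1 : ℕ)) ^ (2 * k) *
        inner ℝ (walkVec e (k + 1) u) (walkVec e (k + 1) v) := by
      rw [Finset.mul_sum]
      exact Finset.sum_congr rfl fun k _ => by ring
    rw [hsh]
    ring

end Covariance

/-! ### Variance and covariance of linear estimators. -/

section Estimator

variable {d : ℕ} {Ω : Type*} {α : ℕ → ℝ} {ε : ℝ} {μ₀ : ℝ} {σ₀sq : ℝ≥0} {X₀ : Ω → ℝ}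
  {W : CoverPair (HS d) → Ω → ℝ}

open Classical in
/-- The extension by zero of a function on the half-space. -/
noncomputable def coeffExt (c : HS d → ℝ) (u : Fin (d + 1) → ℤ) : ℝ :=
  if h : u ∈ HS d then c ⟨u, h⟩ else 0

theorem coeffExt_coe (c : HS d → ℝ) (u : HS d) : coeffExt c u.1 = c u := by
  rw [coeffExt, dif_pos u.2]

theorem mem_layer_iff {u : HS d} {t : ℕ} : u ∈ layer (HS d) t ↔ ∑ i, u.1 i = t := by
  rw [← HS_grade u, Nat.cast_inj]
  rfl

theorem zeta_eq_sum {c : HS d → ℝ} {t : ℕ} {s : Finset (Fin (d + 1) → ℤ)}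
    (hs : ∀ u ∈ s, ∑ i, u i = t) (hc : ∀ u ∈ layer (HS d) t, c u ≠ 0 → u.1 ∈ s) :
    zeta α ε X₀ W c t = fun ω => ∑ u ∈ s, coeffExt c u * XExt α ε X₀ W u ω := by
  classical
  funext ω
  have hHS : ∀ u ∈ s, u ∈ HS d := fun u hu => by
    simp only [HS, Set.mem_ofPred_eq, hs u hu]
    omega
  rw [← Finset.sum_subtype_of_mem _ hHS, zeta,
    finsum_mem_eq_sum_of_inter_support_eq (t := s.subtype (· ∈ HS d))]
  · exact Finset.sum_congr rfl fun u _ => by rw [coeffExt_coe, XExt_coe]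
  · ext u
    simp only [Set.mem_inter_iff, Function.mem_support, Finset.mem_coe, Finset.mem_subtype]
    refine and_congr_left fun hu => ⟨fun h => hc u h (left_ne_zero_of_mul hu), fun h => ?_⟩
    exact mem_layer_iff.2 (hs _ h)

variable [MeasurableSpace Ω] {μ : Measure Ω} {E : Type*} [NormedAddCommGroup E]
  [InnerProductSpace ℝ E] {e : (Fin (d + 1) → ℤ) → E}

theorem IsInput.covariance_sum_X₀ [IsProbabilityMeasure μ] (h : IsInput μ₀ σ₀sq X₀ W μ)
    {t : ℕ} {s : Finset (Fin (d + 1) → ℤ)} (hs : ∀ u ∈ s, ∑ i, u i = t)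
    (c : (Fin (d + 1) → ℤ) → ℝ) :
    covariance (fun ω => ∑ u ∈ s, c u * XExt α ε X₀ W u ω) X₀ μ =
      (α (d + 1) * (d + 1 : ℕ)) ^ t * σ₀sq * ∑ u ∈ s, c u := by
  rw [covariance_fun_sum_left' (fun u hu => (h.memLp_XExt t (hs u hu)).const_mul _) h.memLp_X₀,
    Finset.mul_sum]
  refine Finset.sum_congr rfl fun u hu => ?_
  rw [covariance_const_mul_left, h.covariance_XExt_X₀ t (hs u hu), mul_comm]

theorem IsInput.variance_sum [IsProbabilityMeasure μ] (h : IsInput μ₀ σ₀sq X₀ W μ)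
    (he : Orthonormal ℝ e) {t : ℕ} {s : Finset (Fin (d + 1) → ℤ)} (hs : ∀ u ∈ s, ∑ i, u i = t)
    (c : (Fin (d + 1) → ℤ) → ℝ) :
    variance (fun ω => ∑ u ∈ s, c u * XExt α ε X₀ W u ω) μ =
      (∑ u ∈ s, c u) ^ 2 * ((α (d + 1) * (d + 1 : ℕ)) ^ (2 * t) * σ₀sq) +
      ε ^ 2 * α (d + 1) ^ 2 * (d + 1 : ℕ) *
        ∑ k ∈ Finset.range t, (α (d + 1) * (d + 1 : ℕ)) ^ (2 * k) *
          ‖∑ u ∈ s, c u • walkVec e k u‖ ^ 2 := by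
  have hm : ∀ u ∈ s, MemLp (fun ω => c u * XExt α ε X₀ W u ω) 2 μ := fun u hu =>
    (h.memLp_XExt t (hs u hu)).const_mul _
  have hn : ∀ k, ‖∑ u ∈ s, c u • walkVec e k u‖ ^ 2 =
      ∑ u ∈ s, ∑ v ∈ s, c u * c v * inner ℝ (walkVec e k u) (walkVec e k v) := fun k => by
    rw [← real_inner_self_eq_norm_sq, sum_inner]
    refine Finset.sum_congr rfl fun u _ => ?_
    rw [inner_sum]
    refine Finset.sum_congr rfl fun v _ => ?_
    rw [real_inner_smul_left, real_inner_smul_right, mul_assoc]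
  rw [← covariance_self (memLp_finsetSum _ hm).aemeasurable, covariance_fun_sum_fun_sum' hm hm]
  have hcov : ∀ u ∈ s, ∀ v ∈ s, covariance (fun ω => c u * XExt α ε X₀ W u ω)
      (fun ω => c v * XExt α ε X₀ W v ω) μ =
      c u * c v * ((α (d + 1) * (d + 1 : ℕ)) ^ (2 * t) * σ₀sq) +
      ε ^ 2 * α (d + 1) ^ 2 * (d + 1 : ℕ) *
        ∑ k ∈ Finset.range t, (α (d + 1) * (d + 1 : ℕ)) ^ (2 * k) *
          (c u * c v * inner ℝ (walkVec e k u) (walkVec e k v)) := fun u hu v hv => by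
    rw [covariance_const_mul_left, covariance_const_mul_right,
      h.covariance_XExt_XExt he t (hs u hu) (hs v hv)]
    simp only [mul_left_comm _ (c u * c v), ← Finset.mul_sum]
    ring
  rw [Finset.sum_congr rfl fun u hu => Finset.sum_congr rfl (hcov u hu)]
  simp only [Finset.sum_add_distrib, hn, ← Finset.mul_sum, ← Finset.sum_mul,
    Finset.sum_comm (t := Finset.range t)]
  congr 2
  rw [sq, Finset.sum_mul]

end Estimator

/-! ### Comparison of correlations and the two regimes of `b`. -/

section Main

/-- The correlation with `X₀` of the estimator `X_v` on layer `t`, where `p k` is the probability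
that two independent walks meet after `k` steps. -/
noncomputable def vertexCorr (b σsq κ : ℝ) (p : ℕ → ℝ) (t : ℕ) : ℝ :=
  b ^ t * σsq / √((b ^ (2 * t) * σsq + κ * ∑ k ∈ Finset.range t, b ^ (2 * k) * p k) * σsq)

theorem vertexVariance_pos {b σsq κ : ℝ} (hb : 0 < b) (hσ : 0 < σsq) (hκ : 0 ≤ κ) {p : ℕ → ℝ}
    (hp : ∀ k, 0 ≤ p k) (t : ℕ) :
    0 < b ^ (2 * t) * σsq + κ * ∑ k ∈ Finset.range t, b ^ (2 * k) * p k :=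
  add_pos_of_pos_of_nonneg (by positivity)
    (mul_nonneg hκ (Finset.sum_nonneg fun k _ => mul_nonneg (by positivity) (hp k)))

theorem not_tendsto_vertexCorr {b σsq κ : ℝ} (hb : 1 < b) (hσ : 0 < σsq) (hκ : 0 ≤ κ) {p : ℕ → ℝ}
    (hp : ∀ k, 0 ≤ p k) (hp1 : ∀ k, p k ≤ 1) :
    ¬ Tendsto (vertexCorr b σsq κ p) atTop (𝓝 0) := by
  have hb0 : 0 < b := zero_lt_one.trans hb
  have hb2 : 0 < b ^ 2 - 1 := by nlinarith
  -- The geometric bound `b^(2t) / (b² - 1)` makes the quantity under the root at most `b^(2t) D`,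
  -- so the correlation stays above `σsq / √D`.
  set D := (σsq + κ / (b ^ 2 - 1)) * σsq with hD
  have hDpos : 0 < D := by positivity
  intro h
  refine absurd (ge_of_tendsto' (b := σsq / √D) h fun t => ?_) (not_le.2 (by positivity))
  have hV := vertexVariance_pos hb0 hσ hκ hp t
  have hG : ∑ k ∈ Finset.range t, b ^ (2 * k) * p k ≤ b ^ (2 * t) / (b ^ 2 - 1) := by
    calc ∑ k ∈ Finset.range t, b ^ (2 * k) * p k ≤ ∑ k ∈ Finset.range t, (b ^ 2) ^ k :=
          Finset.sum_le_sum fun k _ => by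
            rw [pow_mul]
            exact mul_le_of_le_one_right (by positivity) (hp1 k)
      _ = ((b ^ 2) ^ t - 1) / (b ^ 2 - 1) := geom_sum_eq (by linarith) t
      _ ≤ b ^ (2 * t) / (b ^ 2 - 1) := by
          rw [pow_mul]
          gcongr
          linarith
  have hle : √((b ^ (2 * t) * σsq + κ * ∑ k ∈ Finset.range t, b ^ (2 * k) * p k) * σsq) ≤
      b ^ t * √D := by
    rw [← Real.sqrt_sq (pow_nonneg hb0.le t), ← Real.sqrt_mul (sq_nonneg _)]
    refine Real.sqrt_le_sqrt ?_
    calc (b ^ (2 * t) * σsq + κ * ∑ k ∈ Finset.range t, b ^ (2 * k) * p k) * σsq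
        ≤ (b ^ (2 * t) * σsq + κ * (b ^ (2 * t) / (b ^ 2 - 1))) * σsq := by gcongr
      _ = (b ^ t) ^ 2 * D := by rw [hD, mul_comm 2 t, pow_mul]; ring
  rw [vertexCorr, div_le_div_iff₀ (by positivity) (Real.sqrt_pos.2 (by positivity))]
  calc σsq * _ ≤ σsq * (b ^ t * √D) := by gcongr
    _ = b ^ t * σsq * √D := by ring

theorem abs_corr_le_vertexCorr {b σsq κ : ℝ} (hb : 0 < b) (hσ : 0 < σsq) (hκ : 0 ≤ κ)
    {p : ℕ → ℝ} (hp : ∀ k, 0 ≤ p k) {M C Q : ℝ} (hM : 1 ≤ M) (hQ0 : 0 ≤ Q) (t : ℕ)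
    (hQ : C ^ 2 * ∑ k ∈ Finset.range t, b ^ (2 * k) * p k ≤ M * Q) :
    |b ^ t * σsq * C / √((C ^ 2 * (b ^ (2 * t) * σsq) + κ * Q) * σsq)| ≤
      √M * vertexCorr b σsq κ p t := by
  have hV := vertexVariance_pos hb hσ hκ hp t
  have hM0 : 0 ≤ M := zero_le_one.trans hM
  rw [vertexCorr]
  set V := b ^ (2 * t) * σsq + κ * ∑ k ∈ Finset.range t, b ^ (2 * k) * p k with hVdef
  set U := C ^ 2 * (b ^ (2 * t) * σsq) + κ * Q with hUdef
  have hU0 : 0 ≤ U := by positivity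
  have hUV : C ^ 2 * V ≤ M * U := by
    -- `1 ≤ M` lets the same constant absorb the part of the variance due to `X₀`.
    have h1 : 0 ≤ (M - 1) * (C ^ 2 * (b ^ (2 * t) * σsq)) :=
      mul_nonneg (by linarith) (by positivity)
    have h2 := mul_le_mul_of_nonneg_left hQ hκ
    rw [hVdef, hUdef]
    linarith
  -- For zero variance the quotient is `0` by the convention on division.
  rcases hU0.eq_or_lt with hU | hU
  · rw [← hU, zero_mul, Real.sqrt_zero, div_zero, abs_zero]
    positivity
  have key : |C| * √(V * σsq) ≤ √M * √(U * σsq) := by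
    rw [← Real.sqrt_sq_eq_abs, ← Real.sqrt_mul (sq_nonneg C), ← Real.sqrt_mul hM0]
    refine Real.sqrt_le_sqrt ?_
    rw [← mul_assoc, ← mul_assoc]
    exact mul_le_mul_of_nonneg_right hUV hσ.le
  rw [abs_div, abs_mul, abs_of_pos (by positivity : 0 < b ^ t * σsq),
    abs_of_nonneg (Real.sqrt_nonneg _), mul_div_assoc', div_le_div_iff₀
      (Real.sqrt_pos.2 (by positivity)) (Real.sqrt_pos.2 (by positivity))]
  calc b ^ t * σsq * |C| * √(V * σsq) = b ^ t * σsq * (|C| * √(V * σsq)) := by ring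
    _ ≤ b ^ t * σsq * (√M * √(U * σsq)) := by gcongr
    _ = √M * (b ^ t * σsq) * √(U * σsq) := by ring

variable {d : ℕ} {Ω : Type*} {α : ℕ → ℝ} {ε : ℝ} {μ₀ : ℝ} {σ₀sq : ℝ≥0} {X₀ : Ω → ℝ}
  {W : CoverPair (HS d) → Ω → ℝ} [MeasurableSpace Ω] {μ : Measure Ω} {E : Type*}
  [NormedAddCommGroup E] [InnerProductSpace ℝ E] {e : (Fin (d + 1) → ℤ) → E}

theorem IsInput.corr_sum [IsProbabilityMeasure μ] (h : IsInput μ₀ σ₀sq X₀ W μ)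
    (he : Orthonormal ℝ e) {t : ℕ} {s : Finset (Fin (d + 1) → ℤ)} (hs : ∀ u ∈ s, ∑ i, u i = t)
    (c : (Fin (d + 1) → ℤ) → ℝ) :
    corr (fun ω => ∑ u ∈ s, c u * XExt α ε X₀ W u ω) X₀ μ =
      (α (d + 1) * (d + 1 : ℕ)) ^ t * σ₀sq * (∑ u ∈ s, c u) /
        √(((∑ u ∈ s, c u) ^ 2 * ((α (d + 1) * (d + 1 : ℕ)) ^ (2 * t) * σ₀sq) +
          ε ^ 2 * α (d + 1) ^ 2 * (d + 1 : ℕ) *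
          ∑ k ∈ Finset.range t, (α (d + 1) * (d + 1 : ℕ)) ^ (2 * k) *
            ‖∑ u ∈ s, c u • walkVec e k u‖ ^ 2) * σ₀sq) := by
  rw [corr, h.covariance_sum_X₀ hs, h.variance_sum he hs, h.variance_X₀]

theorem IsInput.singleVertexReconstruction [IsProbabilityMeasure μ]
    (h : IsInput μ₀ σ₀sq X₀ W μ) (he : Orthonormal ℝ e) (hα : 0 < α (d + 1)) (hσ₀ : 0 < σ₀sq)
    (hr : ¬ Tendsto (vertexCorr (α (d + 1) * (d + 1 : ℕ)) σ₀sq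
      (ε ^ 2 * α (d + 1) ^ 2 * (d + 1 : ℕ)) fun k => ‖walkVec e k 0‖ ^ 2) atTop (𝓝 0)) :
    SingleVertexReconstruction α ε X₀ W μ := by
  classical
  -- Any vertex of the layer would do: by translation invariance the correlation depends only on
  -- `t`.
  let v : ℕ → Fin (d + 1) → ℤ := fun t => Pi.single 0 (t : ℤ)
  have hv : ∀ t, ∑ i, v t i = t := fun t => by simp [v]
  have hvm : ∀ t, v t ∈ HS d := fun t => by
    simp only [HS, Set.mem_ofPred_eq, hv]
    omega
  let c : HS d → ℝ := fun u => if u.1 = v (grade ℕ u) then 1 else 0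
  have hcne : ∀ t, ∀ u ∈ layer (HS d) t, c u ≠ 0 → u.1 = v t := fun t u hu hc => by
    have hg : grade ℕ u = t := hu
    by_contra hne
    exact hc (by simp only [c, hg, if_neg hne])
  have hcv : ∀ t, coeffExt c (v t) = 1 := fun t => by
    have hl : (⟨v t, hvm t⟩ : HS d) ∈ layer (HS d) t := mem_layer_iff.2 (hv t)
    have hg : grade ℕ (⟨v t, hvm t⟩ : HS d) = t := hl
    rw [coeffExt, dif_pos (hvm t)]
    simp only [c, hg, if_true]
  have hs : ∀ t, ∀ u ∈ ({v t} : Finset (Fin (d + 1) → ℤ)), ∑ i, u i = t := fun t u hu => by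
    rw [Finset.mem_singleton.1 hu, hv]
  have hz := fun t => zeta_eq_sum (α := α) (ε := ε) (X₀ := X₀) (W := W) (hs t)
    fun u hu hc => Finset.mem_singleton.2 (hcne t u hu hc)
  refine ⟨v, c, fun t u hu hc i => ?_, fun t => ?_, ?_⟩
  · rw [hcne t u hu hc]
    simp
  · rw [hz, h.variance_sum he (hs t)]
    simp only [Finset.sum_singleton, hcv, one_smul, one_pow, one_mul, norm_walkVec he _ (v t)]
    exact vertexVariance_pos (by positivity) (by exact_mod_cast hσ₀) (by positivity)
      (fun k => sq_nonneg ‖walkVec e k 0‖) t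
  · convert hr using 2
    funext t
    rw [hz, h.corr_sum he (hs t), vertexCorr]
    simp only [Finset.sum_singleton, hcv, one_smul, one_pow, one_mul, mul_one,
      norm_walkVec he _ (v t)]

theorem IsInput.tendsto_corr [IsProbabilityMeasure μ] (h : IsInput μ₀ σ₀sq X₀ W μ)
    (he : Orthonormal ℝ e) (hα : 0 < α (d + 1)) (hσ₀ : 0 < σ₀sq)
    (hb : α (d + 1) * (d + 1 : ℕ) ≤ 1)
    (hr : Tendsto (vertexCorr (α (d + 1) * (d + 1 : ℕ)) σ₀sq
      (ε ^ 2 * α (d + 1) ^ 2 * (d + 1 : ℕ)) fun k => ‖walkVec e k 0‖ ^ 2) atTop (𝓝 0))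
    {N : ℕ} {x : ℕ → Fin (d + 1) → ℤ} {c : HS d → ℝ}
    (hc : ∀ t, ∀ u ∈ layer (HS d) t, c u ≠ 0 → u ∈ window (HS d) N (x t)) :
    Tendsto (fun t => corr (zeta α ε X₀ W c t) X₀ μ) atTop (𝓝 0) := by
  classical
  have hb0 : 0 < α (d + 1) * (d + 1 : ℕ) := by positivity
  obtain ⟨M, hM, hMle⟩ := exists_sq_mul_sum_le he hb0.le hb N
  let s : ℕ → Finset (Fin (d + 1) → ℤ) := fun t =>
    -- A closed box slightly larger than the window; its coordinates still differ by at most `N`.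
    (Finset.Icc (x t) (fun i => x t i + N)).filter fun u => ∑ i, u i = t
  have hs : ∀ t, ∀ u ∈ s t, ∑ i, u i = t := fun t u hu => (Finset.mem_filter.1 hu).2
  have hcs : ∀ t, ∀ u ∈ layer (HS d) t, c u ≠ 0 → u.1 ∈ s t := fun t u hu hcu =>
    Finset.mem_filter.2 ⟨Finset.mem_Icc.2 ⟨fun i => (hc t u hu hcu i).1,
      fun i => (hc t u hu hcu i).2.le⟩, mem_layer_iff.1 hu⟩
  have hclose : ∀ t, ∀ u ∈ s t, ∀ v ∈ s t, ∑ i, u i = ∑ i, v i ∧ ∀ i, |u i - v i| ≤ N :=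
    fun t u hu v hv => by
      refine ⟨(hs t u hu).trans (hs t v hv).symm, fun i => ?_⟩
      have hu' := Finset.mem_Icc.1 (Finset.mem_filter.1 hu).1
      have hv' := Finset.mem_Icc.1 (Finset.mem_filter.1 hv).1
      have h1 := hu'.1 i
      have h2 := hu'.2 i
      have h3 := hv'.1 i
      have h4 := hv'.2 i
      rw [abs_le]
      constructor <;> linarith
  refine squeeze_zero_norm (fun t => ?_) (by simpa only [mul_zero] using hr.const_mul √M)
  rw [zeta_eq_sum (hs t) (hcs t), h.corr_sum he (hs t), Real.norm_eq_abs]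
  exact abs_corr_le_vertexCorr (κ := ε ^ 2 * α (d + 1) ^ 2 * (d + 1 : ℕ)) hb0
    (by exact_mod_cast hσ₀) (by positivity) (fun k => sq_nonneg ‖walkVec e k 0‖) hM
    (Finset.sum_nonneg fun k _ => mul_nonneg (pow_nonneg hb0.le _) (sq_nonneg _)) t
    (hMle (s t) (coeffExt c) t (hclose t))

end Main

end Reconstruction

theorem mainTheorem5 (d : ℕ) (α : ℕ → ℝ) (hα : ∀ i, 1 ≤ i → i ≤ d + 1 → 0 < α i)
    (ε : ℝ) (hε : 0 < ε) (μ₀ : ℝ) (σ₀sq : ℝ≥0) (hσ₀ : 0 < σ₀sq)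
    {Ω : Type*} [MeasurableSpace Ω] (μ : Measure Ω) [IsProbabilityMeasure μ]
    (X₀ : Ω → ℝ) (W : Reconstruction.CoverPair (Reconstruction.HS d) → Ω → ℝ)
    (hXW : Reconstruction.IsInput μ₀ σ₀sq X₀ W μ) :
    Reconstruction.LocalReconstruction α ε X₀ W μ ↔
      Reconstruction.SingleVertexReconstruction α ε X₀ W μ := by
  refine ⟨fun ⟨N, x, c, hc, _, hlim⟩ => ?_, fun h => ⟨1, h⟩⟩
  have hα' := hα (d + 1) (by omega) le_rfl
  -- Any orthonormal family indexed by the lattice works; here it is the default Hilbert basis of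
  -- `ℓ²`.
  have he := (default : HilbertBasis (Fin (d + 1) → ℤ) ℝ
    (lp (fun _ : Fin (d + 1) → ℤ => ℝ) 2)).orthonormal
  refine hXW.singleVertexReconstruction he hα' hσ₀ fun hr => ?_
  rcases le_or_gt (α (d + 1) * (d + 1 : ℕ)) 1 with hb | hb
  · exact hlim (hXW.tendsto_corr he hα' hσ₀ hb hr hc)
  · exact Reconstruction.not_tendsto_vertexCorr hb (by exact_mod_cast hσ₀) (by positivity)
      (fun k => sq_nonneg _) (fun k => Reconstruction.norm_walkVec_le_one he k) hr
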